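/- A configuration on a finite connected graph $G$ is a function $C:V(G)\to\mathbb N$ ($C(x)$ pebbles on the vertex $x$); its size is $\sum_x C(x)$. A pebbling step from a vertex $x$ with $C(x)\ge 2$ to a neighbor $y$ of $x$ removes two pebbles from $x$ and adds one pebble to $y$. For a root $r\in V(G)$, $C$ is $r$-solvable if some finite (possibly empty) sequence of pebbling steps leads from $C$ to a configuration with at least one pebble on $r$, and $\pi(G,r)$ is the minimum $t$ such that every configuration of size $t$ is $r$-solvable. For $m\ge 4$ let $P_{m,2}$ be the generalized Petersen graph with vertices $u$, $v_{i,\emptyset}$, $v_{i,0}$, $v_{i,1}$ for $0\le i<m$, and with edges $u\,v_{i,\emptyset}$ and $v_{i,\emptyset}\,v_{i,x}$ for $0\le i<m$ and $x\in\{0,1\}$, $v_{i,x}\,v_{i+1,x}$ for $0\le i<m-1$ and $x\in\{0,1\}$, and $v_{m-1,x}\,v_{0,1-x}$ for $x\in\{0,1\}$. Theorem. Let $m\ge 4$ and let $n$ be the number of vertices of $P_{m,2}$, so that $n=3m+1$. Put $v=v_{1,\emptyset}$ and $w=v_{1,0}$. Then \begin{enumerate} \item $\pi(P_{m,2},u)=n$,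 \item $\pi(P_{m,2},v)\le n+5$, and \item $\pi(P_{m,2},w)\le n+17$. \end{enumerate} -/

import Mathlib

/-- A configuration of pebbles on the vertex set `V`: `C x` is the number of pebbles on `x`. -/
abbrev PebbleConfig (V : Type*) : Type _ := V → ℕ

/-- The size `|C|` of a configuration: its total number of pebbles. -/
def PebbleConfig.size {V : Type*} [Fintype V] (C : PebbleConfig V) : ℕ := ∑ x, C x

/-- `PebblingStep G C C'`: the configuration `C'` arises from `C` by one pebbling step of `G`, which
takes two pebbles off a vertex `x` and puts one pebble on a neighbor `y` of `x`. -/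
def PebblingStep {V : Type*} [DecidableEq V] (G : SimpleGraph V) (C C' : PebbleConfig V) : Prop :=
  ∃ x y, G.Adj x y ∧ 2 ≤ C x ∧
    C' = Function.update (Function.update C x (C x - 2)) y (C y + 1)

/-- `C` is `r`-solvable if some (possibly empty) finite sequence of pebbling steps leads from `C` to
a configuration with a pebble on the root `r`. -/
def PebbleSolvable {V : Type*} [DecidableEq V] (G : SimpleGraph V) (r : V) (C : PebbleConfig V) :
    Prop :=
  ∃ D : PebbleConfig V, Relation.ReflTransGen (PebblingStep G) C D ∧ 1 ≤ D r

/-- The rooted pebbling number `π(G, r)`: the minimum `t` such that every configuration of size `t`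
is `r`-solvable. Its value is `⊤` if there is no such `t`. -/
noncomputable def rootedPebblingNumber {V : Type*} [Fintype V] [DecidableEq V]
    (G : SimpleGraph V) (r : V) : ℕ∞ :=
  ⨅ t ∈ {t : ℕ | ∀ C : PebbleConfig V, C.size = t → PebbleSolvable G r C}, (t : ℕ∞)

/-- The vertices of `P_{m,2}`: the central vertex `u`, the vertices `v_{i,∅}` (here `v i`), and the
vertices `v_{i,x}` with one binary digit `x` (here `w i x`, with `false` for the digit `0` and `true`
for the digit `1`), where `0 ≤ i < m`. -/
inductive GenPetersenVertex (m : ℕ) : Type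
  | u : GenPetersenVertex m
  | v (i : Fin m) : GenPetersenVertex m
  | w (i : Fin m) (x : Bool) : GenPetersenVertex m
  deriving DecidableEq

/-- The vertices of `P_{m,2}`, listed as a disjoint union. -/
def GenPetersenVertex.equivSum (m : ℕ) :
    (Unit ⊕ (Fin m ⊕ Fin m × Bool)) ≃ GenPetersenVertex m where
  toFun
    | .inl _ => .u
    | .inr (.inl i) => .v i
    | .inr (.inr p) => .w p.1 p.2
  invFun
    | .u => .inl ()
    | .v i => .inr (.inl i)
    | .w i x => .inr (.inr (i, x))
  left_inv := by rintro (_ | _ | _) <;> rfl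
  right_inv := by rintro (_ | _ | _) <;> rfl

instance (m : ℕ) : Fintype (GenPetersenVertex m) :=
  Fintype.ofEquiv _ (GenPetersenVertex.equivSum m)

/-- The edges of `P_{m,2}`, each listed in one direction. -/
inductive GenPetersenEdge (m : ℕ) : GenPetersenVertex m → GenPetersenVertex m → Prop
  | center (i : Fin m) : GenPetersenEdge m .u (.v i)
  | spoke (i : Fin m) (x : Bool) : GenPetersenEdge m (.v i) (.w i x)
  | outer (i j : Fin m) (x : Bool) (h : (j : ℕ) = i + 1) : GenPetersenEdge m (.w i x) (.w j x)
  | twist (i j : Fin m) (x : Bool) (hi : (i : ℕ) + 1 = m) (hj : (j : ℕ) = 0) :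
      GenPetersenEdge m (.w i x) (.w j !x)

/-- The generalized Petersen graph `P_{m,2}`. -/
def genPetersen (m : ℕ) : SimpleGraph (GenPetersenVertex m) :=
  SimpleGraph.fromRel (GenPetersenEdge m)

/-!
The upper bounds come from the weight function method. A *strategy* for the root `r` is a weight
function on the vertices, zero at `r`, such that every vertex of positive weight has a neighbor that
is `r` or that weighs at least twice as much. If the weight `∑ x, w x * C x` of a configuration
exceeds `∑ x, w x`, then some vertex of positive weight holds two pebbles, and moving them along the
strategy either reaches `r` or does not decrease the weight; since the size drops, iterating reaches
`r` (`IsPebblingStrategy.solvable`). Given finitely many strategies whose sum is at least `c` away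
from `r`, every configuration of size `t` is solvable as soon as the total weight of the strategies
is less than `c * t` (`pebbleSolvable_of_strategies`).

* Root `u`: the strategy number `k` puts `4` on `v_k`, `2` on `w_{k,x}` and `1` on the four
  neighbors of the latter on the outer cycle. The strategies add up to `4` on every vertex but `u`,
  for a total of `12 m < 4 n`.
* Root `v_1`: the indices other than `1` form a path of length `m - 1`, which is split according to
  the position modulo `3`. The strategy for a residue puts `8` on `u`, `4` on the `v_j` with `j` in
  the class, `2` on `w_{j,x}`, and `1` on the remaining neighbors of these along the path. Summing
  the three residues gives `24` on `u` and `4` elsewhere, except that the vertices `w_{1,x}` get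
  nothing and their neighbors on the outer cycle only `3`; one further strategy, running through
  `w_{1,x}`, repairs this. The total is `12 m + 20 < 4 (n + 5)`.
* Root `w_{1,0}`: the same three strategies, lengthened by `16` on `v_1` and with `1` on `w_{1,1}`,
  and one further strategy around the root; the total is `12 m + 69 < 4 (n + 17)`.

For the lower bound on `π(P_{m,2}, u)`, a configuration with at most one pebble on every vertex and
none on `u` admits no pebbling step.
-/

/-! ### The weight function method -/

/-- A weight function along which pebbles can be moved towards the root `r` without loss of weight
until `r` is reached: it vanishes at `r`, and every vertex of positive weight has a neighbor that is
`r` or weighs at least twice as much. It is a relaxed form of a rooted tree with weights at least doubling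
towards the root; the parent of a vertex is left unspecified. -/
structure IsPebblingStrategy {V : Type*} (G : SimpleGraph V) (r : V) (w : V → ℕ) : Prop where
  root : w r = 0
  parent : ∀ x, 0 < w x → ∃ y, G.Adj x y ∧ (y = r ∨ 2 * w x ≤ w y)

theorem PebbleSolvable.of_step {V : Type*} [DecidableEq V] {G : SimpleGraph V} {r : V}
    {C C' : PebbleConfig V} (h : PebblingStep G C C') (hC' : PebbleSolvable G r C') :
    PebbleSolvable G r C := by
  obtain ⟨D, hD, hr⟩ := hC'
  exact ⟨D, hD.head h, hr⟩

/-- The effect of a pebbling step on a weighted pebble count. -/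
theorem sum_mul_pebblingStep {V : Type*} [Fintype V] [DecidableEq V] (w C : V → ℕ) {x y : V}
    (hxy : x ≠ y) (hx : 2 ≤ C x) :
    ∑ z, w z * Function.update (Function.update C x (C x - 2)) y (C y + 1) z + 2 * w x
      = ∑ z, w z * C z + w y := by
  have h : ∀ z, w z * Function.update (Function.update C x (C x - 2)) y (C y + 1) z
      + (if z = x then 2 * w x else 0) = w z * C z + (if z = y then w y else 0) := by
    intro z
    by_cases hzy : z = y
    · subst hzy
      simp [hxy.symm]
      ring
    · by_cases hzx : z = x
      · subst hzx
        obtain ⟨k, hk⟩ := Nat.exists_eq_add_of_le hx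
        simp [hzy, hk]
        ring
      · simp [hzy, hzx]
  have := Finset.sum_congr (rfl : (Finset.univ : Finset V) = Finset.univ) fun z _ => h z
  simpa [Finset.sum_add_distrib] using this

/-- The weight function lemma: a configuration that weighs more than one pebble on every vertex is
solvable. -/
theorem IsPebblingStrategy.solvable {V : Type*} [Fintype V] [DecidableEq V] {G : SimpleGraph V}
    {r : V} {w : V → ℕ} (hw : IsPebblingStrategy G r w) (C : PebbleConfig V)
    (hC : ∑ x, w x < ∑ x, w x * C x) : PebbleSolvable G r C := by
  induction hs : C.size using Nat.strong_induction_on generalizing C with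
  | _ s ih =>
    obtain ⟨x, hx⟩ : ∃ x, w x < w x * C x := by
      by_contra! hle
      exact hC.not_ge (Finset.sum_le_sum fun x _ => hle x)
    have hwx : 0 < w x := by
      by_contra! h0
      simp [Nat.le_zero.mp h0] at hx
    have hCx : 2 ≤ C x := by
      by_contra! h
      nlinarith
    obtain ⟨y, hxy, hy⟩ := hw.parent x hwx
    have hstep : PebblingStep G C
        (Function.update (Function.update C x (C x - 2)) y (C y + 1)) :=
      ⟨x, y, hxy, hCx, rfl⟩
    refine PebbleSolvable.of_step hstep ?_
    rcases hy with rfl | hy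
    · exact ⟨_, .refl, by simp⟩
    · have hwt := sum_mul_pebblingStep w C hxy.ne hCx
      have hsize := sum_mul_pebblingStep (fun _ => 1) C hxy.ne hCx
      simp only [one_mul] at hsize
      refine ih _ ?_ _ ?_ rfl
      · unfold PebbleConfig.size at hs ⊢
        omega
      · omega

/-- If finitely many strategies weigh at least `c` together on each vertex other than the root, and
their total weight is less than `c * t`, then every configuration of size `t` is solvable. -/
theorem pebbleSolvable_of_strategies {V ι : Type*} [Fintype V] [DecidableEq V] [Fintype ι]
    {G : SimpleGraph V} {r : V} {w : ι → V → ℕ} (hw : ∀ i, IsPebblingStrategy G r (w i)) {c t : ℕ}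
    (hc : ∀ x, x ≠ r → c ≤ ∑ i, w i x) (ht : ∑ x, ∑ i, w i x < c * t) (C : PebbleConfig V)
    (hC : C.size = t) : PebbleSolvable G r C := by
  by_cases hr : 1 ≤ C r
  · exact ⟨C, .refl, hr⟩
  by_contra hns
  have hle : ∀ i, ∑ x, w i x * C x ≤ ∑ x, w i x := fun i => by
    by_contra! h
    exact hns ((hw i).solvable C h)
  have h1 : c * t ≤ ∑ x, (∑ i, w i x) * C x := by
    rw [← hC, PebbleConfig.size, Finset.mul_sum]
    refine Finset.sum_le_sum fun x _ => ?_
    by_cases hx : x = r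
    · subst hx
      simp [show C x = 0 by omega]
    · exact Nat.mul_le_mul_right _ (hc x hx)
  have h2 : ∑ x, (∑ i, w i x) * C x ≤ ∑ x, ∑ i, w i x := by
    simp_rw [Finset.sum_mul]
    rw [Finset.sum_comm, Finset.sum_comm (f := fun x i => w i x)]
    exact Finset.sum_le_sum fun i _ => hle i
  omega

theorem rootedPebblingNumber_le {V : Type*} [Fintype V] [DecidableEq V] {G : SimpleGraph V} {r : V}
    {t : ℕ} (h : ∀ C : PebbleConfig V, C.size = t → PebbleSolvable G r C) :
    rootedPebblingNumber G r ≤ t :=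
  iInf₂_le t h

/-- The number of vertices is a lower bound for the rooted pebbling number: a configuration with at
most one pebble on each vertex and none on the root is stuck. -/
theorem card_le_rootedPebblingNumber {V : Type*} [Fintype V] [DecidableEq V] (G : SimpleGraph V)
    (r : V) : (Fintype.card V : ℕ∞) ≤ rootedPebblingNumber G r := by
  refine le_iInf₂ fun t ht => ?_
  rw [Nat.cast_le]
  by_contra! hlt
  obtain ⟨s, hs, hcard⟩ := Finset.exists_subset_card_eq
    (show t ≤ (Finset.univ.erase r).card by
      rw [Finset.card_erase_of_mem (Finset.mem_univ r), Finset.card_univ]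
      omega)
  obtain ⟨D, hD, hDr⟩ := ht (fun x => if x ∈ s then 1 else 0) (by simp [PebbleConfig.size, hcard])
  rcases hD.cases_head with rfl | ⟨C', ⟨x, y, -, h2, -⟩, -⟩
  · have hr : r ∉ s := fun h => by simpa using hs h
    simp [hr] at hDr
  · dsimp only at h2
    split_ifs at h2 <;> omega

/-! ### The graph `P_{m,2}` -/

namespace GenPetersenVertex

theorem sum_eq {m : ℕ} (f : GenPetersenVertex m → ℕ) :
    ∑ x, f x = f .u + ∑ i, f (.v i) + ∑ i, (f (.w i false) + f (.w i true)) := by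
  rw [← (equivSum m).sum_comp f]
  simp [Fintype.sum_sum_type, Fintype.sum_prod_type, equivSum, add_assoc, add_comm]

theorem card_eq (m : ℕ) : Fintype.card (GenPetersenVertex m) = 3 * m + 1 := by
  rw [← Fintype.card_congr (equivSum m)]
  simp
  ring

end GenPetersenVertex

theorem genPetersen_adj_u_v {m : ℕ} (i : Fin m) : (genPetersen m).Adj .u (.v i) := by
  simp [genPetersen, GenPetersenEdge.center]

theorem genPetersen_adj_v_w {m : ℕ} (i : Fin m) (x : Bool) :
    (genPetersen m).Adj (.v i) (.w i x) := by
  simp [genPetersen, GenPetersenEdge.spoke]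

theorem genPetersen_adj_w_w {m : ℕ} {i j : Fin m} (x : Bool) (h : (j : ℕ) = i + 1) :
    (genPetersen m).Adj (.w i x) (.w j x) := by
  refine ⟨?_, Or.inl (.outer i j x h)⟩
  rintro ⟨⟩
  omega

/-- `j` follows `i` in the cyclic order of the indices. -/
def CyclicSucc {m : ℕ} (i j : Fin m) : Prop :=
  (j : ℕ) = i + 1 ∨ (i : ℕ) + 1 = m ∧ (j : ℕ) = 0

theorem CyclicSucc.exists_adj {m : ℕ} {i j : Fin m} (h : CyclicSucc i j) (x : Bool) :
    ∃ y, (genPetersen m).Adj (.w i x) (.w j y) := by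
  rcases h with h | ⟨hi, hj⟩
  · exact ⟨x, genPetersen_adj_w_w x h⟩
  · refine ⟨!x, ?_, Or.inl (.twist i j x hi hj)⟩
    simp

theorem CyclicSucc.exists_adj_symm {m : ℕ} {i j : Fin m} (h : CyclicSucc j i) (x : Bool) :
    ∃ y, (genPetersen m).Adj (.w i x) (.w j y) := by
  rcases h with h | ⟨hi, hj⟩
  · exact ⟨x, (genPetersen_adj_w_w x h).symm⟩
  · refine ⟨!x, ?_, Or.inr ?_⟩
    · simp
    · simpa using GenPetersenEdge.twist j i (!x) hi hj

/-! ### The root `u` -/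

/-- The cyclic successor of an index. -/
def cyclicNext {m : ℕ} (i : Fin m) : Fin m :=
  if h : (i : ℕ) + 1 < m then ⟨i + 1, h⟩ else ⟨0, by omega⟩

/-- The cyclic predecessor of an index. -/
def cyclicPrev {m : ℕ} (i : Fin m) : Fin m :=
  if (i : ℕ) = 0 then ⟨m - 1, Nat.sub_lt i.pos one_pos⟩ else ⟨i - 1, by omega⟩

theorem cyclicSucc_cyclicNext {m : ℕ} (i : Fin m) : CyclicSucc i (cyclicNext i) := by
  unfold CyclicSucc cyclicNext
  split_ifs
  · exact Or.inl rfl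
  · exact Or.inr ⟨by omega, rfl⟩

theorem cyclicSucc_cyclicPrev {m : ℕ} (i : Fin m) : CyclicSucc (cyclicPrev i) i := by
  unfold CyclicSucc cyclicPrev
  split_ifs <;> dsimp only <;> omega

/-- The strategy for the root `u` through `v k`: weight `4` on `v k`, `2` on its outer neighbors,
and `1` on the neighbors of these on the outer cycle. -/
def centerStrategy {m : ℕ} (k : Fin m) : GenPetersenVertex m → ℕ
  | .u => 0
  | .v i => if i = k then 4 else 0
  | .w i _ => (if i = k then 2 else 0) + (if cyclicNext i = k then 1 else 0)
      + (if cyclicPrev i = k then 1 else 0)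

theorem isPebblingStrategy_centerStrategy {m : ℕ} (hm : 3 ≤ m) (k : Fin m) :
    IsPebblingStrategy (genPetersen m) .u (centerStrategy k) := by
  refine ⟨rfl, ?_⟩
  have hdistinct : ∀ i : Fin m,
      cyclicNext i ≠ i ∧ cyclicPrev i ≠ i ∧ cyclicNext i ≠ cyclicPrev i := by
    intro i
    unfold cyclicNext cyclicPrev
    refine ⟨?_, ?_, ?_⟩ <;> rw [Ne, Fin.ext_iff] <;> split_ifs <;> dsimp only <;> omega
  rintro (_ | i | ⟨i, x⟩) hpos
  · simp [centerStrategy] at hpos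
  · exact ⟨.u, (genPetersen_adj_u_v i).symm, Or.inl rfl⟩
  · obtain ⟨h1, h2, h3⟩ := hdistinct i
    by_cases hi : i = k
    · subst hi
      exact ⟨.v i, (genPetersen_adj_v_w i x).symm, Or.inr (by simp [centerStrategy, h1, h2])⟩
    by_cases hn : cyclicNext i = k
    · obtain ⟨y, hy⟩ := (cyclicSucc_cyclicNext i).exists_adj x
      refine ⟨_, hy, Or.inr ?_⟩
      have hp : cyclicPrev i ≠ k := fun h => h3 (hn.trans h.symm)
      simp [centerStrategy, hi, hn, hp]
      omega
    · obtain ⟨y, hy⟩ := (cyclicSucc_cyclicPrev i).exists_adj_symm x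
      refine ⟨_, hy, Or.inr ?_⟩
      have hp : cyclicPrev i = k := by
        by_contra hp
        simp [centerStrategy, hi, hn, hp] at hpos
      simp [centerStrategy, hi, hn, hp]
      omega

theorem rootedPebblingNumber_genPetersen_u {m : ℕ} (hm : 3 ≤ m) :
    rootedPebblingNumber (genPetersen m) .u = (3 * m + 1 : ℕ) := by
  refine le_antisymm (rootedPebblingNumber_le ?_) ?_
  · refine pebbleSolvable_of_strategies (c := 4)
      (isPebblingStrategy_centerStrategy hm) ?_ ?_
    · rintro (_ | i | ⟨i, x⟩) h
      · exact absurd rfl h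
      · simp [centerStrategy]
      · simp [centerStrategy, Finset.sum_add_distrib]
    · rw [GenPetersenVertex.sum_eq]
      simp [centerStrategy, Finset.sum_add_distrib]
      omega
  · rw [← GenPetersenVertex.card_eq]
    exact card_le_rootedPebblingNumber _ _

/-! ### Strategies through `u` on the indices other than `1` -/

/-- The number of cyclic steps from the index `1` to the index `j`. -/
def indexOffset {m : ℕ} (j : Fin m) : ℕ := if (j : ℕ) = 0 then m - 1 else j - 1

theorem indexOffset_lt {m : ℕ} (j : Fin m) : indexOffset j < m := by
  unfold indexOffset
  split_ifs <;> omega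

theorem cyclicSucc_of_indexOffset {m : ℕ} {i j : Fin m} (h : indexOffset j = indexOffset i + 1) :
    CyclicSucc i j := by
  unfold indexOffset at h
  unfold CyclicSucc
  split_ifs at h <;> omega

theorem exists_indexOffset_eq {m d : ℕ} (hd : d < m) : ∃ j : Fin m, indexOffset j = d := by
  unfold indexOffset
  by_cases h : d + 1 = m
  · exact ⟨⟨0, by omega⟩, by simp; omega⟩
  · exact ⟨⟨d + 1, by omega⟩, by simp⟩

theorem indexOffset_eq_zero_iff {m : ℕ} (hm : 2 ≤ m) (j : Fin m) :
    indexOffset j = 0 ↔ j = ⟨1, by omega⟩ := by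
  unfold indexOffset
  rw [Fin.ext_iff]
  split_ifs <;> dsimp only <;> omega

/-- The weight of the outer vertices at offset `d` in the strategy for the residue `a` modulo `3`:
`2` for offsets in the class, `1` for those adjacent to one in the class. Offset `0`, that of the
root, belongs to no class. -/
def outerWeight (m a d : ℕ) : ℕ :=
  if d = 0 then 0
  else if d % 3 = a then 2
  else if (d + 1) % 3 = a then (if d + 1 < m then 1 else 0)
  else if d = 1 then 0 else 1

theorem outerWeight_le_two (m a d : ℕ) : outerWeight m a d ≤ 2 := by
  unfold outerWeight
  split_ifs <;> omega

/-- An outer vertex of positive weight is in the class or next to an offset in the class. -/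
theorem outerWeight_cases {m a d : ℕ} (ha : a < 3) (hpos : 0 < outerWeight m a d) :
    d ≠ 0 ∧ d % 3 = a ∨
    outerWeight m a d = 1 ∧ d + 1 < m ∧ outerWeight m a (d + 1) = 2 ∨
    outerWeight m a d = 1 ∧ 1 ≤ d ∧ outerWeight m a (d - 1) = 2 := by
  unfold outerWeight at *
  split_ifs at * <;> omega

theorem sum_outerWeight {m d : ℕ} (hm : 3 ≤ m) (hd : d < m) :
    outerWeight m 0 d + outerWeight m 1 d + outerWeight m 2 d =
      if d = 0 then 0 else if d = 1 ∨ d + 1 = m then 3 else 4 := by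
  unfold outerWeight
  split_ifs <;> omega

/-- The strategy for the residue `a` modulo `3`, moving pebbles to `u` from the indices other than
`1`. The weights `p` on `v_1` and `q x` on `w_{1,x}` are those with which it continues from `u` to
the root. -/
def residueStrategy {m : ℕ} (p : ℕ) (q : Bool → ℕ) (a : ℕ) : GenPetersenVertex m → ℕ
  | .u => 8
  | .v j => if indexOffset j = 0 then p else if indexOffset j % 3 = a then 4 else 0
  | .w j x => if indexOffset j = 0 then q x else outerWeight m a (indexOffset j)

/-- Away from the index `1`, every vertex of positive weight has the neighbor that a strategy
requires. -/
theorem residueStrategy_parent {m : ℕ} (p : ℕ) (q : Bool → ℕ) {a : ℕ} (ha : a < 3) :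
    (∀ j : Fin m, indexOffset j ≠ 0 → ∃ y, (genPetersen m).Adj (.v j) y ∧
      2 * residueStrategy p q a (.v j) ≤ residueStrategy p q a y) ∧
    (∀ (j : Fin m) (x : Bool), indexOffset j ≠ 0 → 0 < residueStrategy p q a (.w j x) →
      ∃ y, (genPetersen m).Adj (.w j x) y ∧
        2 * residueStrategy p q a (.w j x) ≤ residueStrategy p q a y) := by
  refine ⟨fun j hj => ⟨.u, (genPetersen_adj_u_v j).symm, ?_⟩, fun j x hj hpos => ?_⟩
  · simp only [residueStrategy, hj, if_false]
    split_ifs <;> omega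
  have hw : ∀ (i : Fin m) (y : Bool), indexOffset i ≠ 0 →
      residueStrategy p q a (.w i y) = outerWeight m a (indexOffset i) := by
    intro i y hi
    simp [residueStrategy, hi]
  -- Weight `2` is never attained at offset `0`.
  have hne : ∀ d, outerWeight m a d = 2 → d ≠ 0 := by
    rintro d hd rfl
    simp [outerWeight] at hd
  rw [hw j x hj] at hpos ⊢
  rcases outerWeight_cases ha hpos with ⟨-, h⟩ | ⟨h1, hlt, h2⟩ | ⟨h1, hle, h2⟩
  · refine ⟨.v j, (genPetersen_adj_v_w j x).symm, ?_⟩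
    have := outerWeight_le_two m a (indexOffset j)
    simp only [residueStrategy, hj, h, if_false, if_true]
    omega
  · obtain ⟨i, hi⟩ := exists_indexOffset_eq hlt
    obtain ⟨y, hy⟩ := (cyclicSucc_of_indexOffset hi).exists_adj x
    refine ⟨_, hy, ?_⟩
    rw [hw i y (by omega), hi]
    omega
  · obtain ⟨i, hi⟩ := exists_indexOffset_eq
      (show indexOffset j - 1 < m by have := indexOffset_lt j; omega)
    obtain ⟨y, hy⟩ := (cyclicSucc_of_indexOffset (i := i) (j := j) (by omega)).exists_adj_symm x
    refine ⟨_, hy, ?_⟩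
    have := hne _ h2
    rw [hw i y (by omega), hi]
    omega

/-- The outer vertices with index `0` or `2`, which are the neighbors of the `w_{1,x}` on the outer
cycle, are those with offset `m - 1` or `1`. -/
theorem indexOffset_eq_one_or_iff {m : ℕ} (hm : 3 ≤ m) (j : Fin m) :
    (indexOffset j = 1 ∨ indexOffset j + 1 = m) ↔ ((j : ℕ) = 2 ∨ (j : ℕ) = 0) := by
  unfold indexOffset
  split_ifs <;> omega

theorem sum_ite_indexOffset_eq_zero {m : ℕ} (hm : 2 ≤ m) (p c : ℕ) :
    ∑ j : Fin m, (if indexOffset j = 0 then p else c) + c = p + m * c := by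
  have h : ∀ j : Fin m, (if indexOffset j = 0 then p else c) +
      (if j = ⟨1, by omega⟩ then c else 0) = (if j = ⟨1, by omega⟩ then p else 0) + c := by
    intro j
    have := indexOffset_eq_zero_iff hm j
    split_ifs <;> simp_all
  have hs := Finset.sum_congr (rfl : (Finset.univ : Finset (Fin m)) = Finset.univ) fun j _ => h j
  simpa [Finset.sum_add_distrib] using hs

/-- An outer vertex next to some `w_{1,x}` is adjacent to the one with its own digit. -/
theorem genPetersen_adj_w_one {m : ℕ} (hm : 2 ≤ m) {j : Fin m} (hj : (j : ℕ) = 2 ∨ (j : ℕ) = 0)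
    (x : Bool) : (genPetersen m).Adj (.w j x) (.w ⟨1, by omega⟩ x) := by
  rcases hj with hj | hj
  · exact (genPetersen_adj_w_w x (by simp [hj])).symm
  · exact genPetersen_adj_w_w x (by simp [hj])

/-! ### The root `v_1` -/

/-- The strategy for the root `v_1` that runs through `w_{1,0}` and `w_{1,1}`. -/
def spokeStrategy {m : ℕ} : GenPetersenVertex m → ℕ
  | .u => 0
  | .v _ => 0
  | .w j _ => if indexOffset j = 0 then 4 else
      if indexOffset j = 1 ∨ indexOffset j + 1 = m then 1 else 0

theorem isPebblingStrategy_spokeStrategy {m : ℕ} (hm : 3 ≤ m) :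
    IsPebblingStrategy (genPetersen m) (.v ⟨1, by omega⟩) spokeStrategy := by
  refine ⟨rfl, ?_⟩
  have hone : indexOffset (⟨1, by omega⟩ : Fin m) = 0 := (indexOffset_eq_zero_iff (by omega) _).2 rfl
  rintro (_ | j | ⟨j, x⟩) hpos
  · simp [spokeStrategy] at hpos
  · simp [spokeStrategy] at hpos
  by_cases hj : indexOffset j = 0
  · exact ⟨.v j, (genPetersen_adj_v_w j x).symm,
      Or.inl (congrArg _ ((indexOffset_eq_zero_iff (by omega) j).1 hj))⟩
  · have hj' : indexOffset j = 1 ∨ indexOffset j + 1 = m := by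
      by_contra h
      simp [spokeStrategy, hj, h] at hpos
    refine ⟨_, genPetersen_adj_w_one (by omega) ((indexOffset_eq_one_or_iff hm j).1 hj') x,
      Or.inr ?_⟩
    simp only [spokeStrategy, hone, hj, hj', if_true, if_false]
    omega

theorem isPebblingStrategy_residueStrategy_v {m : ℕ} (hm : 2 ≤ m) {a : ℕ} (ha : a < 3) :
    IsPebblingStrategy (genPetersen m) (.v ⟨1, by omega⟩) (residueStrategy 0 (fun _ => 0) a) := by
  have hone : indexOffset (⟨1, by omega⟩ : Fin m) = 0 := (indexOffset_eq_zero_iff hm _).2 rfl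
  obtain ⟨hv, hw⟩ := residueStrategy_parent 0 (fun _ => 0) ha
  refine ⟨by simp [residueStrategy, hone], ?_⟩
  rintro (_ | j | ⟨j, x⟩) hpos
  · exact ⟨_, genPetersen_adj_u_v _, Or.inl rfl⟩
  · obtain ⟨y, hy, hle⟩ := hv j (fun h => by simp [residueStrategy, h] at hpos)
    exact ⟨y, hy, Or.inr hle⟩
  · obtain ⟨y, hy, hle⟩ := hw j x (fun h => by simp [residueStrategy, h] at hpos) hpos
    exact ⟨y, hy, Or.inr hle⟩

theorem rootedPebblingNumber_genPetersen_v_le {m : ℕ} (hm : 3 ≤ m) :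
    rootedPebblingNumber (genPetersen m) (.v ⟨1, by omega⟩) ≤ (3 * m + 6 : ℕ) := by
  refine rootedPebblingNumber_le ?_
  set w : Fin 4 → GenPetersenVertex m → ℕ := ![residueStrategy 0 (fun _ => 0) 0,
    residueStrategy 0 (fun _ => 0) 1, residueStrategy 0 (fun _ => 0) 2, spokeStrategy] with hwdef
  have hu : ∑ i, w i .u = 24 := by
    simp [hwdef, Fin.sum_univ_four, residueStrategy, spokeStrategy]
  have hv : ∀ j, ∑ i, w i (.v j) = if indexOffset j = 0 then 0 else 4 := by
    intro j
    simp only [hwdef, Fin.sum_univ_four, residueStrategy, spokeStrategy, Matrix.cons_val]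
    split_ifs <;> omega
  have hw : ∀ j x, ∑ i, w i (.w j x) = 4 := by
    intro j x
    have := sum_outerWeight hm (indexOffset_lt j)
    simp only [hwdef, Fin.sum_univ_four, residueStrategy, spokeStrategy, Matrix.cons_val]
    split_ifs at * <;> omega
  refine pebbleSolvable_of_strategies (w := w) (c := 4) ?_ ?_ ?_
  · simp only [Fin.forall_fin_succ, IsEmpty.forall_iff, and_true]
    exact ⟨isPebblingStrategy_residueStrategy_v (by omega) (by omega),
      isPebblingStrategy_residueStrategy_v (by omega) (by omega),
      isPebblingStrategy_residueStrategy_v (by omega) (by omega),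
      isPebblingStrategy_spokeStrategy hm⟩
  · rintro (_ | j | ⟨j, x⟩) h
    · rw [hu]
      omega
    · have : indexOffset j ≠ 0 := fun h0 =>
        h (congrArg _ ((indexOffset_eq_zero_iff (by omega) j).1 h0))
      rw [hv, if_neg this]
    · rw [hw]
  · rw [GenPetersenVertex.sum_eq]
    simp only [hu, hv, hw]
    have := sum_ite_indexOffset_eq_zero (m := m) (by omega) 0 4
    simp only [Finset.sum_const, Finset.card_univ, Fintype.card_fin, smul_eq_mul]
    omega

/-! ### The root `w_{1,0}` -/

/-- The strategy for the root `w_{1,0}` that runs through its three neighbors. -/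
def outerStrategy {m : ℕ} : GenPetersenVertex m → ℕ
  | .u => 0
  | .v j => if indexOffset j = 0 then 4 else 0
  | .w j x => if indexOffset j = 0 then (if x then 2 else 0) else
      if indexOffset j = 1 ∨ indexOffset j + 1 = m then 1 else 0

theorem isPebblingStrategy_outerStrategy {m : ℕ} (hm : 3 ≤ m) :
    IsPebblingStrategy (genPetersen m) (.w ⟨1, by omega⟩ false) outerStrategy := by
  have hone : indexOffset (⟨1, by omega⟩ : Fin m) = 0 := (indexOffset_eq_zero_iff (by omega) _).2 rfl
  refine ⟨by simp [outerStrategy, hone], ?_⟩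
  rintro (_ | j | ⟨j, x⟩) hpos
  · simp [outerStrategy] at hpos
  · have hj : indexOffset j = 0 := by
      by_contra h
      simp [outerStrategy, h] at hpos
    exact ⟨.w j false, genPetersen_adj_v_w j false,
      Or.inl (by rw [(indexOffset_eq_zero_iff (by omega) j).1 hj])⟩
  by_cases hj : indexOffset j = 0
  · refine ⟨.v j, (genPetersen_adj_v_w j x).symm, Or.inr ?_⟩
    simp only [outerStrategy, hj, if_true]
    split_ifs <;> omega
  · have hj' : indexOffset j = 1 ∨ indexOffset j + 1 = m := by
      by_contra h
      simp [outerStrategy, hj, h] at hpos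
    refine ⟨_, genPetersen_adj_w_one (by omega) ((indexOffset_eq_one_or_iff hm j).1 hj') x, ?_⟩
    cases x
    · exact Or.inl rfl
    · refine Or.inr ?_
      simp only [outerStrategy, hone, hj, hj', if_true, if_false]
      omega

theorem isPebblingStrategy_residueStrategy_w {m : ℕ} (hm : 2 ≤ m) {a : ℕ} (ha : a < 3) :
    IsPebblingStrategy (genPetersen m) (.w ⟨1, by omega⟩ false)
      (residueStrategy 16 (fun x => if x then 1 else 0) a) := by
  have hone : indexOffset (⟨1, by omega⟩ : Fin m) = 0 := (indexOffset_eq_zero_iff hm _).2 rfl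
  obtain ⟨hv, hw⟩ := residueStrategy_parent 16 (fun x => if x then 1 else 0) ha
  refine ⟨by simp [residueStrategy, hone], ?_⟩
  rintro (_ | j | ⟨j, x⟩) hpos
  · exact ⟨.v ⟨1, by omega⟩, genPetersen_adj_u_v _, Or.inr (by simp [residueStrategy, hone])⟩
  · by_cases hj : indexOffset j = 0
    · exact ⟨.w j false, genPetersen_adj_v_w j false,
        Or.inl (by rw [(indexOffset_eq_zero_iff (by omega) j).1 hj])⟩
    · obtain ⟨y, hy, hle⟩ := hv j hj
      exact ⟨y, hy, Or.inr hle⟩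
  · by_cases hj : indexOffset j = 0
    · refine ⟨.v j, (genPetersen_adj_v_w j x).symm, Or.inr ?_⟩
      simp only [residueStrategy, hj, if_true]
      split_ifs <;> omega
    · obtain ⟨y, hy, hle⟩ := hw j x hj hpos
      exact ⟨y, hy, Or.inr hle⟩

theorem rootedPebblingNumber_genPetersen_w_le {m : ℕ} (hm : 3 ≤ m) :
    rootedPebblingNumber (genPetersen m) (.w ⟨1, by omega⟩ false) ≤ (3 * m + 18 : ℕ) := by
  refine rootedPebblingNumber_le ?_
  set q : Bool → ℕ := fun x => if x then 1 else 0 with hq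
  set w : Fin 4 → GenPetersenVertex m → ℕ := ![residueStrategy 16 q 0, residueStrategy 16 q 1,
    residueStrategy 16 q 2, outerStrategy] with hwdef
  have hu : ∑ i, w i .u = 24 := by
    simp [hwdef, Fin.sum_univ_four, residueStrategy, outerStrategy]
  have hv : ∀ j, ∑ i, w i (.v j) = if indexOffset j = 0 then 52 else 4 := by
    intro j
    simp only [hwdef, Fin.sum_univ_four, residueStrategy, outerStrategy, Matrix.cons_val]
    split_ifs <;> omega
  have hw : ∀ j x, ∑ i, w i (.w j x) =
      if indexOffset j = 0 then (if x then 5 else 0) else 4 := by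
    intro j x
    have := sum_outerWeight hm (indexOffset_lt j)
    simp only [hwdef, hq, Fin.sum_univ_four, residueStrategy, outerStrategy, Matrix.cons_val]
    split_ifs at * <;> omega
  refine pebbleSolvable_of_strategies (w := w) (c := 4) ?_ ?_ ?_
  · simp only [Fin.forall_fin_succ, IsEmpty.forall_iff, and_true]
    exact ⟨isPebblingStrategy_residueStrategy_w (by omega) (by omega),
      isPebblingStrategy_residueStrategy_w (by omega) (by omega),
      isPebblingStrategy_residueStrategy_w (by omega) (by omega),
      isPebblingStrategy_outerStrategy hm⟩
  · rintro (_ | j | ⟨j, x⟩) h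
    · rw [hu]
      omega
    · rw [hv]
      split_ifs <;> omega
    · rw [hw]
      by_cases hj : indexOffset j = 0
      · cases x
        · exact absurd (by rw [(indexOffset_eq_zero_iff (by omega) j).1 hj]) h
        · simp [hj]
      · simp [hj]
  · rw [GenPetersenVertex.sum_eq]
    have hpair : ∀ j : Fin m, ∑ i, w i (.w j false) + ∑ i, w i (.w j true) =
        if indexOffset j = 0 then 5 else 8 := by
      intro j
      rw [hw, hw]
      split_ifs <;> simp_all
    simp only [hu, hv, hpair]
    have h1 := sum_ite_indexOffset_eq_zero (m := m) (by omega) 52 4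
    have h2 := sum_ite_indexOffset_eq_zero (m := m) (by omega) 5 8
    omega

theorem mainTheorem5 (m : ℕ) (hm : 4 ≤ m) (n : ℕ)
    (hn : n = Fintype.card (GenPetersenVertex m)) :
    n = 3 * m + 1 ∧
    rootedPebblingNumber (genPetersen m) .u = n ∧
    rootedPebblingNumber (genPetersen m) (.v ⟨1, by omega⟩) ≤ n + 5 ∧
    rootedPebblingNumber (genPetersen m) (.w ⟨1, by omega⟩ false) ≤ n + 17 := by
  have hcard : n = 3 * m + 1 := hn.trans (GenPetersenVertex.card_eq m)
  subst hcard
  exact ⟨rfl, rootedPebblingNumber_genPetersen_u (by omega),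
    by exact_mod_cast rootedPebblingNumber_genPetersen_v_le (m := m) (by omega),
    by exact_mod_cast rootedPebblingNumber_genPetersen_w_le (m := m) (by omega)⟩
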